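/- Conventions. Let $R$ be an integral domain with quotient field $\operatorname{qf}(R)$. For a nonzero fractional ideal $I$ of $R$ put $I^{-1}=\{x\in \operatorname{qf}(R) : xI\subseteq R\}$, $I_v=(I^{-1})^{-1}$, and $I_t=\bigcup J_v$, where $J$ ranges over the nonzero finitely generated fractional ideals of $R$ contained in $I$. A fractional $t$-ideal of $R$ is a nonzero fractional ideal $I$ with $I=I_t$. The $t$-class semigroup $\mathcal S_t(R)$ is the set of fractional $t$-ideals of $R$ modulo the nonzero principal fractional ideals (that is, $I$ and $J$ are identified if $J=cI$ for some nonzero $c\in\operatorname{qf}(R)$), with the operation induced by $t$-multiplication $(I,J)\mapsto (IJ)_t$. The domain $R$ is called Boole $t$-regular if $\mathcal S_t(R)$ is a Boolean semigroup, i.e. $x=x^2$ for every $x\in\mathcal S_t(R)$. Proposition 2.3. Let $(T,M)$ be a local Noetherian domain with residue field $K=T/M$, let $\varphi:T\to K$ be the canonical surjection, let $k$ be a proper subfield of $K$, and let $R:=\varphi^{-1}(k)\subseteq T$. Then $R$ is Boole $t$-regular if and only if $T$ is Boole $t$-regular. -/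

import Mathlib

open scoped nonZeroDivisors

noncomputable section

namespace TClass

variable {R K : Type*} [CommRing R] [IsDomain R] [Field K] [Algebra R K] [IsFractionRing R K]

/-- The divisorial closure `I_v = (I⁻¹)⁻¹` of a fractional ideal `I` of the domain `R` with
quotient field `K`, where `I⁻¹ = {x ∈ K | x I ⊆ R}` for `I ≠ 0` (and `0⁻¹ = 0`, so `0_v = 0`). -/
def vClosure (I : FractionalIdeal R⁰ K) : FractionalIdeal R⁰ K := I⁻¹⁻¹

theorem vClosure_zero : vClosure (0 : FractionalIdeal R⁰ K) = 0 := by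
  simp [vClosure, FractionalIdeal.inv_zero']

theorem inv_ne_zero_of_ne_zero {I : FractionalIdeal R⁰ K} (hI : I ≠ 0) : I⁻¹ ≠ 0 := by
  obtain ⟨a, ha, h⟩ := I.isFractional
  intro h0
  have hmem : algebraMap R K a ∈ I⁻¹ := by
    rw [FractionalIdeal.mem_inv_iff hI]
    intro y hy
    obtain ⟨r, hr⟩ := h y hy
    rw [FractionalIdeal.mem_one_iff]
    exact ⟨r, by rw [hr, Algebra.smul_def]⟩
  rw [h0, FractionalIdeal.mem_zero_iff] at hmem
  exact (nonZeroDivisors.ne_zero ha) ((IsFractionRing.injective R K) (by simpa using hmem))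

theorem mem_vClosure_iff {I : FractionalIdeal R⁰ K} (hI : I ≠ 0) {x : K} :
    x ∈ vClosure I ↔ ∀ y : K, (∀ z ∈ I, y * z ∈ (1 : FractionalIdeal R⁰ K)) →
      x * y ∈ (1 : FractionalIdeal R⁰ K) := by
  rw [vClosure, FractionalIdeal.mem_inv_iff (inv_ne_zero_of_ne_zero hI)]
  simp only [FractionalIdeal.mem_inv_iff hI]

theorem le_vClosure (I : FractionalIdeal R⁰ K) : I ≤ vClosure I := by
  by_cases hI : I = 0
  · subst hI; rw [vClosure_zero]
  intro x hx
  rw [mem_vClosure_iff hI]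
  intro y hy
  rw [mul_comm]
  exact hy x hx

theorem vClosure_mono {I J : FractionalIdeal R⁰ K} (h : I ≤ J) : vClosure I ≤ vClosure J := by
  by_cases hI : I = 0
  · subst hI; rw [vClosure_zero]; exact FractionalIdeal.zero_le _
  have hJ : J ≠ 0 := by
    rintro rfl
    exact hI (le_antisymm h (FractionalIdeal.zero_le _))
  intro x hx
  rw [mem_vClosure_iff hI] at hx
  rw [mem_vClosure_iff hJ]
  exact fun y hy => hx y fun z hz => hy z (h hz)

theorem vClosure_ne_zero {I : FractionalIdeal R⁰ K} (hI : I ≠ 0) : vClosure I ≠ 0 :=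
  inv_ne_zero_of_ne_zero (inv_ne_zero_of_ne_zero hI)

theorem vClosure_idem (I : FractionalIdeal R⁰ K) : vClosure (vClosure I) = vClosure I := by
  by_cases hI : I = 0
  · subst hI; simp only [vClosure_zero]
  refine le_antisymm ?_ (le_vClosure _)
  intro x hx
  rw [mem_vClosure_iff (vClosure_ne_zero hI)] at hx
  rw [mem_vClosure_iff hI]
  intro y hy
  refine hx y fun z hz => ?_
  rw [mul_comm]
  exact (mem_vClosure_iff hI).1 hz y hy

/-- The union of the `J_v`, where `J` ranges over the finitely generated fractional ideals
contained in `I`, as an `R`-submodule of `K`. -/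
def tClosureSubmodule (I : FractionalIdeal R⁰ K) : Submodule R K where
  carrier := {x | ∃ J : FractionalIdeal R⁰ K,
    J ≤ I ∧ (J : Submodule R K).FG ∧ x ∈ vClosure J}
  zero_mem' := ⟨0, FractionalIdeal.zero_le _, by simpa using Submodule.fg_bot,
    Submodule.zero_mem _⟩
  add_mem' := by
    rintro x y ⟨J, hJ, hJf, hx⟩ ⟨L, hL, hLf, hy⟩
    refine ⟨J ⊔ L, sup_le hJ hL, ?_, ?_⟩
    · rw [FractionalIdeal.coe_sup]; exact hJf.sup hLf
    · exact Submodule.add_mem _ (vClosure_mono le_sup_left hx) (vClosure_mono le_sup_right hy)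
  smul_mem' := by
    rintro r x ⟨J, hJ, hJf, hx⟩
    exact ⟨J, hJ, hJf, Submodule.smul_mem _ r hx⟩

theorem tClosureSubmodule_le (I : FractionalIdeal R⁰ K) :
    tClosureSubmodule I ≤ (vClosure I : Submodule R K) := by
  intro x hx
  obtain ⟨J, hJ, -, hx⟩ : ∃ J : FractionalIdeal R⁰ K,
    J ≤ I ∧ (J : Submodule R K).FG ∧ x ∈ vClosure J := hx
  exact vClosure_mono hJ hx

/-- The `t`-closure `I_t = ⋃ J_v`, where `J` ranges over the finitely generated fractional ideals
contained in `I`. -/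
def tClosure (I : FractionalIdeal R⁰ K) : FractionalIdeal R⁰ K :=
  ⟨tClosureSubmodule I, FractionalIdeal.isFractional_of_le (tClosureSubmodule_le I)⟩

theorem mem_tClosure_iff {I : FractionalIdeal R⁰ K} {x : K} :
    x ∈ tClosure I ↔ ∃ J : FractionalIdeal R⁰ K,
      J ≤ I ∧ (J : Submodule R K).FG ∧ x ∈ vClosure J := by
  rw [← FractionalIdeal.mem_coe]
  exact Iff.rfl

set_option linter.unusedSectionVars false in
theorem mul_ne_zero_of_ne_zero {I J : FractionalIdeal R⁰ K} (hI : I ≠ 0) (hJ : J ≠ 0) :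
    I * J ≠ 0 := by
  intro h
  apply hI
  rw [FractionalIdeal.eq_zero_iff]
  intro x hx
  by_contra hx0
  apply hJ
  rw [FractionalIdeal.eq_zero_iff]
  intro y hy
  have := FractionalIdeal.mul_mem_mul hx hy
  rw [h, FractionalIdeal.mem_zero_iff] at this
  exact (mul_eq_zero.1 this).resolve_left hx0

theorem le_tClosure (I : FractionalIdeal R⁰ K) : I ≤ tClosure I := by
  intro x hx
  refine mem_tClosure_iff.2 ⟨FractionalIdeal.spanSingleton R⁰ x, ?_, ?_, ?_⟩
  · exact FractionalIdeal.spanSingleton_le_iff_mem.2 hx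
  · rw [FractionalIdeal.coe_spanSingleton]; exact Submodule.fg_span_singleton x
  · exact le_vClosure _ (FractionalIdeal.mem_spanSingleton_self _ x)

theorem tClosure_le_vClosure (I : FractionalIdeal R⁰ K) : tClosure I ≤ vClosure I :=
  tClosureSubmodule_le I

theorem tClosure_mono {I J : FractionalIdeal R⁰ K} (h : I ≤ J) : tClosure I ≤ tClosure J := by
  intro x hx
  obtain ⟨L, hL, hLf, hx⟩ := mem_tClosure_iff.1 hx
  exact mem_tClosure_iff.2 ⟨L, hL.trans h, hLf, hx⟩

theorem exists_fg_le_vClosure {I F : FractionalIdeal R⁰ K} (hF : (F : Submodule R K).FG)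
    (h : F ≤ tClosure I) :
    ∃ J : FractionalIdeal R⁰ K, J ≤ I ∧ (J : Submodule R K).FG ∧ F ≤ vClosure J := by
  obtain ⟨s, hs⟩ := hF
  have key : ∀ s : Finset K, (∀ x ∈ s, x ∈ tClosure I) →
      ∃ J : FractionalIdeal R⁰ K, J ≤ I ∧ (J : Submodule R K).FG ∧ ∀ x ∈ s, x ∈ vClosure J := by
    classical
    intro s
    induction s using Finset.induction_on with
    | empty =>
      intro _
      exact ⟨0, FractionalIdeal.zero_le _, by simpa using Submodule.fg_bot, by simp⟩
    | insert a s _ ih =>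
      intro hs
      obtain ⟨J, hJ, hJf, hJs⟩ := ih fun x hx => hs x (Finset.mem_insert_of_mem hx)
      obtain ⟨L, hL, hLf, ha⟩ := mem_tClosure_iff.1 (hs a (Finset.mem_insert_self _ _))
      refine ⟨J ⊔ L, sup_le hJ hL, by rw [FractionalIdeal.coe_sup]; exact hJf.sup hLf, ?_⟩
      intro x hx
      rcases Finset.mem_insert.1 hx with rfl | hx
      · exact vClosure_mono le_sup_right ha
      · exact vClosure_mono le_sup_left (hJs x hx)
  have hsF : ∀ x ∈ s, x ∈ F := fun x hx => by
    rw [← FractionalIdeal.mem_coe, ← hs]; exact Submodule.subset_span hx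
  obtain ⟨J, hJ, hJf, hJs⟩ := key s fun x hx => h (hsF x hx)
  refine ⟨J, hJ, hJf, ?_⟩
  rw [← FractionalIdeal.coe_le_coe, ← hs, Submodule.span_le]
  exact hJs

theorem tClosure_idem (I : FractionalIdeal R⁰ K) : tClosure (tClosure I) = tClosure I := by
  refine le_antisymm ?_ (le_tClosure _)
  intro x hx
  obtain ⟨F, hF, hFf, hx⟩ := mem_tClosure_iff.1 hx
  obtain ⟨J, hJ, hJf, hFJ⟩ := exists_fg_le_vClosure hFf hF
  refine mem_tClosure_iff.2 ⟨J, hJ, hJf, ?_⟩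
  rw [← vClosure_idem]
  exact vClosure_mono hFJ hx

theorem tClosure_ne_zero {I : FractionalIdeal R⁰ K} (hI : I ≠ 0) : tClosure I ≠ 0 := by
  intro h
  exact hI (le_antisymm (h ▸ le_tClosure I) (FractionalIdeal.zero_le _))

theorem tClosure_one : tClosure (1 : FractionalIdeal R⁰ K) = 1 := by
  refine le_antisymm ((tClosure_le_vClosure _).trans ?_) (le_tClosure _)
  simp [vClosure]

theorem mul_mem_vClosure {I : FractionalIdeal R⁰ K} {x : K} (hx : x ∈ vClosure I) (c : K) :
    x * c ∈ vClosure (I * FractionalIdeal.spanSingleton R⁰ c) := by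
  by_cases hc : c = 0
  · subst hc; rw [mul_zero]; exact Submodule.zero_mem _
  by_cases hI : I = 0
  · subst hI
    rw [vClosure_zero, FractionalIdeal.mem_zero_iff] at hx
    rw [hx, zero_mul, zero_mul]
    exact Submodule.zero_mem
      (vClosure (0 : FractionalIdeal R⁰ K) : Submodule R K)
  have hIc : I * FractionalIdeal.spanSingleton R⁰ c ≠ 0 :=
    mul_ne_zero_of_ne_zero hI (FractionalIdeal.spanSingleton_ne_zero_iff.2 hc)
  rw [mem_vClosure_iff hI] at hx
  rw [mem_vClosure_iff hIc]
  intro y hy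
  rw [mul_assoc]
  refine hx _ fun z hz => ?_
  have := hy (z * c) (FractionalIdeal.mul_mem_mul hz (FractionalIdeal.mem_spanSingleton_self _ c))
  rwa [show c * y * z = y * (z * c) by ring]

theorem tClosure_mul_le (I J : FractionalIdeal R⁰ K) : tClosure I * J ≤ tClosure (I * J) := by
  rw [FractionalIdeal.mul_le]
  intro x hx y hy
  obtain ⟨F, hF, hFf, hx⟩ := mem_tClosure_iff.1 hx
  refine mem_tClosure_iff.2 ⟨F * FractionalIdeal.spanSingleton R⁰ y, ?_, ?_, mul_mem_vClosure hx y⟩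
  · exact mul_le_mul' hF (FractionalIdeal.spanSingleton_le_iff_mem.2 hy)
  · rw [FractionalIdeal.coe_mul, FractionalIdeal.coe_spanSingleton]
    exact hFf.mul (Submodule.fg_span_singleton y)

theorem tClosure_tClosure_mul (I J : FractionalIdeal R⁰ K) :
    tClosure (tClosure I * J) = tClosure (I * J) := by
  refine le_antisymm ?_ (tClosure_mono (mul_le_mul' (le_tClosure I) le_rfl))
  exact (tClosure_mono (tClosure_mul_le I J)).trans (tClosure_idem _).le

theorem tClosure_mul_tClosure (I J : FractionalIdeal R⁰ K) :
    tClosure (I * tClosure J) = tClosure (I * J) := by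
  rw [mul_comm, tClosure_tClosure_mul, mul_comm]

theorem tClosure_spanSingleton_mul {c : K} (hc : c ≠ 0) (I : FractionalIdeal R⁰ K) :
    tClosure (FractionalIdeal.spanSingleton R⁰ c * I) =
      FractionalIdeal.spanSingleton R⁰ c * tClosure I := by
  have hle : ∀ (d : K) (J : FractionalIdeal R⁰ K),
      FractionalIdeal.spanSingleton R⁰ d * tClosure J ≤
        tClosure (FractionalIdeal.spanSingleton R⁰ d * J) := fun d J => by
    rw [mul_comm, mul_comm _ J]; exact tClosure_mul_le J _
  have h1 : FractionalIdeal.spanSingleton R⁰ c * FractionalIdeal.spanSingleton R⁰ c⁻¹ = 1 := by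
    rw [FractionalIdeal.spanSingleton_mul_spanSingleton, mul_inv_cancel₀ hc,
      FractionalIdeal.spanSingleton_one]
  refine le_antisymm ?_ (hle c I)
  have h2 := hle c⁻¹ (FractionalIdeal.spanSingleton R⁰ c * I)
  rw [← mul_assoc, mul_comm (FractionalIdeal.spanSingleton R⁰ c⁻¹)
    (FractionalIdeal.spanSingleton R⁰ c), h1, one_mul] at h2
  have h3 := mul_le_mul' (le_refl (FractionalIdeal.spanSingleton R⁰ c)) h2
  rwa [← mul_assoc, h1, one_mul] at h3

/-- The (nonzero, fractional) `t`-ideals of `R`: the nonzero fractional ideals `I` with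
`I = I_t`. -/
@[ext]
structure TIdeal (R K : Type*) [CommRing R] [IsDomain R] [Field K] [Algebra R K]
    [IsFractionRing R K] where
  /-- The underlying fractional ideal. -/
  val : FractionalIdeal R⁰ K
  ne_zero : val ≠ 0
  eq_tClosure : val = tClosure val

/-- The `t`-ideals form a commutative monoid under `t`-multiplication `(I, J) ↦ (I J)_t`. -/
instance TIdeal.instCommMonoid : CommMonoid (TIdeal R K) where
  mul I J := ⟨tClosure (I.val * J.val), tClosure_ne_zero (mul_ne_zero_of_ne_zero I.ne_zero J.ne_zero),
    (tClosure_idem _).symm⟩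
  one := ⟨1, one_ne_zero, tClosure_one.symm⟩
  mul_assoc I J L := TIdeal.ext (show tClosure (tClosure (I.val * J.val) * L.val) =
      tClosure (I.val * tClosure (J.val * L.val)) by
    rw [tClosure_tClosure_mul, tClosure_mul_tClosure, mul_assoc])
  one_mul I := TIdeal.ext (show tClosure (1 * I.val) = I.val by rw [one_mul, ← I.eq_tClosure])
  mul_one I := TIdeal.ext (show tClosure (I.val * 1) = I.val by rw [mul_one, ← I.eq_tClosure])
  mul_comm I J := TIdeal.ext (show tClosure (I.val * J.val) = tClosure (J.val * I.val) by
    rw [mul_comm])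

theorem TIdeal.mul_val (I J : TIdeal R K) : (I * J).1 = tClosure (I.val * J.val) := rfl

/-- Two `t`-ideals are identified when they differ by a nonzero principal fractional ideal, that is,
when `J = c I` for some nonzero `c` in the quotient field. This is a congruence. -/
def tClassCon (R K : Type*) [CommRing R] [IsDomain R] [Field K] [Algebra R K]
    [IsFractionRing R K] : Con (TIdeal R K) where
  r I J := ∃ c : K, c ≠ 0 ∧ J.val = FractionalIdeal.spanSingleton R⁰ c * I.val
  iseqv :=
    { refl := fun I => ⟨1, one_ne_zero, by rw [FractionalIdeal.spanSingleton_one, one_mul]⟩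
      symm := by
        rintro I J ⟨c, hc, h⟩
        refine ⟨c⁻¹, inv_ne_zero hc, ?_⟩
        rw [h, ← mul_assoc, FractionalIdeal.spanSingleton_mul_spanSingleton, inv_mul_cancel₀ hc,
          FractionalIdeal.spanSingleton_one, one_mul]
      trans := by
        rintro I J L ⟨c, hc, h⟩ ⟨d, hd, h'⟩
        refine ⟨d * c, mul_ne_zero hd hc, ?_⟩
        rw [h', h, ← mul_assoc, FractionalIdeal.spanSingleton_mul_spanSingleton] }
  mul' := by
    rintro I J L N ⟨c, hc, h⟩ ⟨d, hd, h'⟩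
    refine ⟨c * d, mul_ne_zero hc hd, ?_⟩
    rw [TIdeal.mul_val, TIdeal.mul_val, h, h', mul_mul_mul_comm,
      FractionalIdeal.spanSingleton_mul_spanSingleton,
      tClosure_spanSingleton_mul (mul_ne_zero hc hd)]

/-- The `t`-class semigroup `S_t(R)` of a domain `R`: the fractional `t`-ideals modulo the nonzero
principal fractional ideals, with the operation induced by `t`-multiplication. -/
abbrev TClassSemigroup (R : Type*) [CommRing R] [IsDomain R] : Type _ :=
  (tClassCon R (FractionRing R)).Quotient

/-- A semigroup is Boolean if `x = x²` for each of its elements. -/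
def IsBooleanSemigroup (S : Type*) [Semigroup S] : Prop :=
  ∀ x : S, x = x * x

/-- A domain is Boole `t`-regular if its `t`-class semigroup is Boolean. -/
def IsBooleTRegular (R : Type*) [CommRing R] [IsDomain R] : Prop :=
  IsBooleanSemigroup (TClassSemigroup R)

end TClass

end

/-! If `T` is a field, so is `R`, and both class semigroups are trivial. Otherwise `R` and `T` are
local with the same maximal ideal `M` and the same quotient field. Both conditions are compared with
one about fractional ideals of `T` and the closure `I ↦ (M : (M : I))`, called `mClosure`.

Passage from `R` to `T`: if `I` is not principal over a local domain, then `I⁻¹ = (M : I)`, because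
a unit in `xI` would make `I` principal. As `M` is a `T`-module, `(M : I) = (M : IT)`, and a nonzero
`T`-module is never principal over `R ≠ T`. Hence `I_v = (M : (M : IT))` for nonprincipal `I`
(`vClosure_eq_restrict`). Since `T` is Noetherian, this also gives `t = v` on `R`. So the `t`-ideals
of `R` are the principal ones and the `mClosure`-closed ideals of `T`
(`tSquaresSimilar_iff_mSquares`).

Inside `T`, where `t = v`: `mClosure I` and `I_v` differ only when `I_v = cT` with `I` nonprincipal,
and then `mClosure I = cM`. The exceptional ideals are thus multiples of `M`, and a study of `M²`
settles them (`vSquares_iff_mSquares`). -/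

open scoped nonZeroDivisors

set_option linter.unusedSectionVars false

noncomputable section

namespace TClass

open FractionalIdeal

/-! ### Independence of the chosen quotient field; basic facts on `v`- and `t`-closure. -/

section Basic

variable {R : Type*} (K : Type*) [CommRing R] [IsDomain R] [Field K] [Algebra R K]
  [IsFractionRing R K]

/-- Every `t`-ideal of `R` in the quotient field `K` is `t`-idempotent up to a principal factor. -/
def TSquaresSimilar (R K : Type*) [CommRing R] [IsDomain R] [Field K] [Algebra R K]
    [IsFractionRing R K] : Prop :=
  ∀ I : FractionalIdeal R⁰ K, I ≠ 0 → tClosure I = I →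
    ∃ c : K, c ≠ 0 ∧ tClosure (I * I) = spanSingleton R⁰ c * I

theorem isBooleTRegular_iff_fractionRing :
    IsBooleTRegular R ↔ TSquaresSimilar R (FractionRing R) := by
  constructor
  · intro h I hI hIt
    exact (Con.eq (tClassCon R (FractionRing R))).1
      (h ((⟨I, hI, hIt.symm⟩ : TIdeal R (FractionRing R)) :
        (tClassCon R (FractionRing R)).Quotient))
  · intro h x
    induction x using Con.induction_on with
    | H I => exact (Con.eq (tClassCon R (FractionRing R))).2 (h I.val I.ne_zero I.eq_tClosure.symm)

variable {K} {K' : Type*} [Field K'] [Algebra R K'] [IsFractionRing R K']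

theorem vClosure_map (g : K ≃ₐ[R] K') (I : FractionalIdeal R⁰ K) :
    vClosure (I.map (g : K →ₐ[R] K')) = (vClosure I).map (g : K →ₐ[R] K') := by
  rw [vClosure, vClosure, FractionalIdeal.map_inv, FractionalIdeal.map_inv]

theorem map_tClosure_le (g : K ≃ₐ[R] K') (I : FractionalIdeal R⁰ K) :
    (tClosure I).map (g : K →ₐ[R] K') ≤ tClosure (I.map (g : K →ₐ[R] K')) := by
  intro x hx
  obtain ⟨y, hy, rfl⟩ := mem_map.1 hx
  obtain ⟨J, hJ, hJf, hy⟩ := mem_tClosure_iff.1 hy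
  refine mem_tClosure_iff.2 ⟨J.map (g : K →ₐ[R] K'), ?_, ?_, ?_⟩
  · intro z hz
    obtain ⟨w, hw, rfl⟩ := mem_map.1 hz
    exact mem_map.2 ⟨w, hJ hw, rfl⟩
  · rw [FractionalIdeal.coe_map]
    exact hJf.map _
  · rw [vClosure_map]
    exact mem_map.2 ⟨y, hy, rfl⟩

theorem tClosure_map (g : K ≃ₐ[R] K') (I : FractionalIdeal R⁰ K) :
    tClosure (I.map (g : K →ₐ[R] K')) = (tClosure I).map (g : K →ₐ[R] K') := by
  refine le_antisymm ?_ (map_tClosure_le g I)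
  have h := map_tClosure_le g.symm (I.map (g : K →ₐ[R] K'))
  rw [FractionalIdeal.map_map_symm] at h
  intro x hx
  have hx' := h (mem_map.2 ⟨x, hx, rfl⟩)
  exact mem_map.2 ⟨_, hx', by simp⟩

theorem TSquaresSimilar.transfer (g : K ≃ₐ[R] K') (h : TSquaresSimilar R K) :
    TSquaresSimilar R K' := by
  intro I hI hIt
  obtain ⟨c, hc, hcI⟩ := h (I.map (g.symm : K' →ₐ[R] K))
    (fun h0 => hI (by
      rw [← FractionalIdeal.map_symm_map I g, h0, FractionalIdeal.map_zero]))
    (by rw [tClosure_map, hIt])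
  refine ⟨g c, by simpa using hc, ?_⟩
  have h2 := congrArg (FractionalIdeal.map (g : K →ₐ[R] K')) hcI
  rw [← FractionalIdeal.map_mul, tClosure_map, FractionalIdeal.map_symm_map,
    FractionalIdeal.map_mul, FractionalIdeal.map_symm_map] at h2
  rw [h2]
  congr 1
  ext x
  simp only [mem_map, mem_spanSingleton]
  constructor
  · rintro ⟨_, ⟨z, rfl⟩, rfl⟩
    exact ⟨z, by simp⟩
  · rintro ⟨z, rfl⟩
    exact ⟨z • c, ⟨z, rfl⟩, by simp⟩

-- Allows the class semigroups of `R` and `T` to be studied inside one common quotient field.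
variable (R K) in
theorem isBooleTRegular_iff : IsBooleTRegular R ↔ TSquaresSimilar R K := by
  rw [isBooleTRegular_iff_fractionRing]
  exact ⟨.transfer (FractionRing.algEquiv R K), .transfer (FractionRing.algEquiv R K).symm⟩

theorem isBooleTRegular_of_isField (hR : IsField R) : IsBooleTRegular R := by
  rw [isBooleTRegular_iff_fractionRing]
  let := hR.toField
  intro I hI _
  have hI1 : I = 1 := (FractionalIdeal.eq_zero_or_one I).resolve_left hI
  exact ⟨1, one_ne_zero, by rw [hI1, mul_one, mul_one, tClosure_one, spanSingleton_one]⟩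

theorem vClosure_spanSingleton (c : K) :
    vClosure (spanSingleton R⁰ c) = spanSingleton R⁰ c := by
  rw [vClosure, spanSingleton_inv, spanSingleton_inv, inv_inv]

theorem inv_vClosure (I : FractionalIdeal R⁰ K) : (vClosure I)⁻¹ = I⁻¹ := by
  by_cases hI : I = 0
  · simp [hI, vClosure_zero]
  · exact le_antisymm (inv_anti_mono hI (vClosure_ne_zero hI) (le_vClosure I)) (le_vClosure I⁻¹)

theorem tClosure_eq_vClosure_of_fg_le {I J : FractionalIdeal R⁰ K}
    (hJ : (J : Submodule R K).FG) (hJI : J ≤ I) (h : vClosure I ≤ vClosure J) :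
    tClosure I = vClosure I :=
  le_antisymm (tClosure_le_vClosure I) fun _ hx => mem_tClosure_iff.2 ⟨J, hJI, hJ, h hx⟩

theorem tClosure_eq_vClosure [IsNoetherianRing R] (I : FractionalIdeal R⁰ K) :
    tClosure I = vClosure I :=
  tClosure_eq_vClosure_of_fg_le ((isNoetherian_submodule.1 (isNoetherian I)) _ le_rfl)
    le_rfl le_rfl

theorem spanSingleton_inv_mul_cancel {c : K} (hc : c ≠ 0) (I : FractionalIdeal R⁰ K) :
    spanSingleton R⁰ c⁻¹ * (spanSingleton R⁰ c * I) = I := by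
  rw [← mul_assoc, spanSingleton_mul_spanSingleton, inv_mul_cancel₀ hc, spanSingleton_one, one_mul]

theorem mul_mem_spanSingleton_mul {c x : K} {I : FractionalIdeal R⁰ K} (hx : x ∈ I) :
    c * x ∈ spanSingleton R⁰ c * I :=
  FractionalIdeal.mul_mem_mul (mem_spanSingleton_self _ c) hx

theorem div_spanSingleton_mul (L I : FractionalIdeal R⁰ K) {c : K} (hc : c ≠ 0) (hI : I ≠ 0) :
    L / (spanSingleton R⁰ c * I) = spanSingleton R⁰ c⁻¹ * (L / I) := by
  have hcI : spanSingleton R⁰ c * I ≠ 0 :=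
    mul_ne_zero_of_ne_zero (spanSingleton_ne_zero_iff.2 hc) hI
  ext x
  rw [mem_div_iff_of_ne_zero hcI, mem_singleton_mul]
  constructor
  · intro h
    refine ⟨x * c, (mem_div_iff_of_ne_zero hI).2 fun y hy => ?_, ?_⟩
    · rw [mul_assoc]
      exact h _ (mul_mem_spanSingleton_mul hy)
    · field_simp
  · rintro ⟨y, hy, rfl⟩ z hz
    obtain ⟨w, hw, rfl⟩ := mem_singleton_mul.1 hz
    have := (mem_div_iff_of_ne_zero hI).1 hy w hw
    rwa [show c⁻¹ * y * (c * w) = y * w by field_simp]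

theorem vClosure_spanSingleton_mul {c : K} (hc : c ≠ 0) (I : FractionalIdeal R⁰ K) :
    vClosure (spanSingleton R⁰ c * I) = spanSingleton R⁰ c * vClosure I := by
  by_cases hI : I = 0
  · simp [hI, vClosure_zero]
  · have h {d : K} (hd : d ≠ 0) {J : FractionalIdeal R⁰ K} (hJ : J ≠ 0) :
        (spanSingleton R⁰ d * J)⁻¹ = spanSingleton R⁰ d⁻¹ * J⁻¹ :=
      div_spanSingleton_mul 1 J hd hJ
    rw [vClosure, vClosure, h hc hI, h (inv_ne_zero hc) (inv_ne_zero_of_ne_zero hI), inv_inv]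

theorem ne_zero_of_spanSingleton_eq {I : FractionalIdeal R⁰ K} (hI : I ≠ 0) {c : K}
    (h : I = spanSingleton R⁰ c) : c ≠ 0 := by
  rintro rfl
  exact hI (by rw [h, spanSingleton_zero])

end Basic

/-! ### The closure `(M : (M : I))` over a local domain. -/

section Local

variable (R K : Type*) [CommRing R] [IsDomain R] [IsLocalRing R] [Field K] [Algebra R K]
  [IsFractionRing R K]

/-- The maximal ideal of a local domain as a fractional ideal. -/
def fracMax : FractionalIdeal R⁰ K := (IsLocalRing.maximalIdeal R : FractionalIdeal R⁰ K)

variable {R K}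

theorem mem_fracMax {x : K} :
    x ∈ fracMax R K ↔ ∃ r ∈ IsLocalRing.maximalIdeal R, algebraMap R K r = x := by
  simp [fracMax, mem_coeIdeal]

theorem fracMax_le_one : fracMax R K ≤ 1 := coeIdeal_le_one

theorem fracMax_ne_zero (h : ¬ IsField R) : fracMax R K ≠ 0 :=
  coeIdeal_ne_zero.2 (mt IsLocalRing.isField_iff_maximalIdeal_eq.2 h)

theorem div_ne_zero_of_ne_zero {I J : FractionalIdeal R⁰ K} (hI : I ≠ 0) (hJ : J ≠ 0) :
    I / J ≠ 0 := by
  intro h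
  refine mul_ne_zero_of_ne_zero hI (inv_ne_zero_of_ne_zero hJ) (le_antisymm ?_ (zero_le _))
  rw [← h, le_div_iff_mul_le hJ, mul_assoc, mul_comm J⁻¹, inv_eq]
  exact (mul_le_mul' le_rfl mul_one_div_le_one).trans_eq (mul_one I)

/-- If `xI ⊆ R` but `xy` is a unit for some `y ∈ I`, then every `z ∈ I` is `(xz)(xy)⁻¹y`, so `y`
generates `I`. -/
theorem inv_eq_fracMax_div {I : FractionalIdeal R⁰ K} (hI : I ≠ 0)
    (h : ∀ c, I ≠ spanSingleton R⁰ c) : I⁻¹ = fracMax R K / I := by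
  ext x
  rw [mem_inv_iff hI, mem_div_iff_of_ne_zero hI]
  refine ⟨fun hx y hy => ?_, fun hx y hy => fracMax_le_one (hx y hy)⟩
  obtain ⟨r, hr⟩ := (mem_one_iff _).1 (hx y hy)
  by_cases hrM : r ∈ IsLocalRing.maximalIdeal R
  · exact mem_fracMax.2 ⟨r, hrM, hr⟩
  exfalso
  obtain ⟨u, rfl⟩ := IsLocalRing.notMem_maximalIdeal.1 hrM
  refine h y (le_antisymm (fun z hz => ?_) (spanSingleton_le_iff_mem.2 hy))
  obtain ⟨s, hs⟩ := (mem_one_iff _).1 (hx z hz)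
  have hu : algebraMap R K ((u⁻¹ : Rˣ) : R) * (x * y) = 1 := by
    rw [← hr, ← map_mul, Units.inv_mul, map_one]
  refine (mem_spanSingleton _).2 ⟨s * ((u⁻¹ : Rˣ) : R), ?_⟩
  rw [Algebra.smul_def, map_mul, hs]
  linear_combination z * hu

/-- The closure `(M : (M : I))` of `I`, where `M` is the maximal ideal. -/
def mClosure (I : FractionalIdeal R⁰ K) : FractionalIdeal R⁰ K :=
  fracMax R K / (fracMax R K / I)

theorem mClosure_ne_zero (h : ¬ IsField R) {I : FractionalIdeal R⁰ K} (hI : I ≠ 0) :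
    mClosure I ≠ 0 :=
  div_ne_zero_of_ne_zero (fracMax_ne_zero h) (div_ne_zero_of_ne_zero (fracMax_ne_zero h) hI)

theorem mClosure_spanSingleton_mul (h : ¬ IsField R) {I : FractionalIdeal R⁰ K} (hI : I ≠ 0)
    {c : K} (hc : c ≠ 0) :
    mClosure (spanSingleton R⁰ c * I) = spanSingleton R⁰ c * mClosure I := by
  rw [mClosure, mClosure, div_spanSingleton_mul _ _ hc hI, div_spanSingleton_mul _ _
    (inv_ne_zero hc) (div_ne_zero_of_ne_zero (fracMax_ne_zero h) hI), inv_inv]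

/-- When `I_v` is not principal, neither `I` nor `I⁻¹` is, so both inverses may be taken into `M`
instead of `R`. -/
theorem mClosure_eq_vClosure {I : FractionalIdeal R⁰ K} (hI : I ≠ 0)
    (h : ∀ c, vClosure I ≠ spanSingleton R⁰ c) : mClosure I = vClosure I := by
  have hI' : ∀ c, I ≠ spanSingleton R⁰ c := by
    rintro c rfl
    exact h c (vClosure_spanSingleton c)
  have hI'' : ∀ c, I⁻¹ ≠ spanSingleton R⁰ c := fun c hc =>
    h c⁻¹ (by rw [vClosure, hc, spanSingleton_inv])
  rw [mClosure, ← inv_eq_fracMax_div hI hI',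
    ← inv_eq_fracMax_div (inv_ne_zero_of_ne_zero hI) hI'', vClosure]

/-- The one case where the closures differ: `(M : I) = I⁻¹ = c⁻¹R`, and `(M : c⁻¹R) = cM`. -/
theorem mClosure_eq_of_vClosure_eq {I : FractionalIdeal R⁰ K} (hI : I ≠ 0)
    (h : ∀ c, I ≠ spanSingleton R⁰ c) {c : K} (hc : vClosure I = spanSingleton R⁰ c) :
    mClosure I = spanSingleton R⁰ c * fracMax R K := by
  rw [mClosure, ← inv_eq_fracMax_div hI h, ← inv_vClosure, hc, spanSingleton_inv,
    div_spanSingleton, inv_inv]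

end Local

/-! ### Squares of ideals under the two closures. -/

section LocalSquares

variable {R K : Type*} [CommRing R] [IsDomain R] [IsLocalRing R] [Field K] [Algebra R K]
  [IsFractionRing R K]

theorem div_mul_eq_div_div {L I J : FractionalIdeal R⁰ K} (hI : I ≠ 0) (hJ : J ≠ 0) :
    L / (I * J) = L / I / J := by
  refine eq_of_forall_le_iff fun N => ?_
  rw [le_div_iff_mul_le (mul_ne_zero_of_ne_zero hI hJ), le_div_iff_mul_le hJ,
    le_div_iff_mul_le hI, mul_comm I J, mul_assoc]

/-- Invertible ideals of a local domain are principal: for nonprincipal `I`, `I⁻¹I ⊆ M`. -/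
theorem mul_ne_one_of_ne_spanSingleton {I : FractionalIdeal R⁰ K} (hI : I ≠ 0)
    (h : ∀ c, I ≠ spanSingleton R⁰ c) (J : FractionalIdeal R⁰ K) : I * J ≠ 1 := by
  intro hIJ
  have hinv := (mul_inv_cancel_iff K).2 ⟨J, hIJ⟩
  have hle : I⁻¹ * I ≤ fracMax R K := by
    rw [← le_div_iff_mul_le hI, inv_eq_fracMax_div hI h]
  rw [mul_comm, hinv] at hle
  obtain ⟨r, hr, hr1⟩ := mem_fracMax.1 (hle (one_mem_one R⁰))
  rw [← map_one (algebraMap R K)] at hr1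
  rw [IsFractionRing.injective R K hr1] at hr
  exact (Ideal.ne_top_iff_one _).1 (IsLocalRing.maximalIdeal.isMaximal R).ne_top hr

theorem fracMax_ne_one : fracMax R K ≠ 1 := by
  intro h
  obtain ⟨r, hr, hr1⟩ := mem_fracMax.1 (h.ge (one_mem_one R⁰))
  rw [← map_one (algebraMap R K)] at hr1
  rw [IsFractionRing.injective R K hr1] at hr
  exact (Ideal.ne_top_iff_one _).1 (IsLocalRing.maximalIdeal.isMaximal R).ne_top hr

/-- Here `M⁻¹ = R`, so `(M : M²) = ((M : M) : M) = (M⁻¹ : M) = (R : M) = R`. -/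
theorem mClosure_fracMax_mul_fracMax (hR : ¬ IsField R)
    (h : ∀ c, fracMax R K ≠ spanSingleton R⁰ c) (hv : vClosure (fracMax R K) = 1) :
    mClosure (fracMax R K * fracMax R K) = fracMax R K := by
  have hM : fracMax R K ≠ 0 := fracMax_ne_zero hR
  have hinv : (fracMax R K)⁻¹ = 1 := by
    rw [← inv_vClosure, hv, ← spanSingleton_one, spanSingleton_inv, inv_one]
  rw [mClosure, div_mul_eq_div_div hM hM, ← inv_eq_fracMax_div hM h, hinv, ← inv_eq, hinv,
    FractionalIdeal.div_one]

/-- If the maximal ideal `M` is divisorial and not principal, `(M²)_v` is not principal. -/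
theorem vClosure_fracMax_mul_fracMax_ne (hR : ¬ IsField R)
    (h : ∀ c, fracMax R K ≠ spanSingleton R⁰ c) (hv : vClosure (fracMax R K) = fracMax R K)
    (c : K) : vClosure (fracMax R K * fracMax R K) ≠ spanSingleton R⁰ c := by
  intro hc
  have hM : fracMax R K ≠ 0 := fracMax_ne_zero hR
  have hMM := mul_ne_zero_of_ne_zero hM hM
  have hc0 : c ≠ 0 := by
    rintro rfl
    exact vClosure_ne_zero hMM (by rw [hc, spanSingleton_zero])
  have hinv : (fracMax R K * fracMax R K)⁻¹ = spanSingleton R⁰ c⁻¹ := by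
    rw [← inv_vClosure, hc, spanSingleton_inv]
  -- `M⁻¹M ⊆ M` implies that `M⁻¹` multiplies `(M²)⁻¹ = c⁻¹R` into itself, so `M⁻¹ ⊆ R`.
  have hle : (fracMax R K)⁻¹ ≤ 1 := by
    have hmul : (fracMax R K)⁻¹ * spanSingleton R⁰ c⁻¹ ≤ spanSingleton R⁰ c⁻¹ := by
      rw [← hinv]
      nth_rw 3 [inv_eq]
      rw [le_div_iff_mul_le hMM, inv_eq (I := fracMax R K * fracMax R K)]
      have h1 : (fracMax R K)⁻¹ * fracMax R K ≤ fracMax R K := by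
        rw [← le_div_iff_mul_le hM, inv_eq_fracMax_div hM h]
      calc _ = ((fracMax R K)⁻¹ * fracMax R K) *
            (fracMax R K * (1 / (fracMax R K * fracMax R K))) := by ring
        _ ≤ fracMax R K * (fracMax R K * (1 / (fracMax R K * fracMax R K))) :=
          mul_le_mul' h1 le_rfl
        _ = (fracMax R K * fracMax R K) * (1 / (fracMax R K * fracMax R K)) := by ring
        _ ≤ 1 := mul_one_div_le_one
    have := mul_le_mul' hmul (le_refl (spanSingleton R⁰ c))
    rwa [mul_assoc, spanSingleton_mul_spanSingleton, inv_mul_cancel₀ hc0, spanSingleton_one,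
      mul_one] at this
  have h1 : (fracMax R K)⁻¹ = 1 := by
    refine le_antisymm hle ?_
    rw [inv_eq, le_div_iff_mul_le hM, one_mul]
    exact fracMax_le_one
  -- `M⁻¹ = R` gives `M_v = R`, against `M_v = M`.
  refine fracMax_ne_one (R := R) (K := K) ?_
  rw [← hv, vClosure, h1, ← spanSingleton_one, spanSingleton_inv, inv_one]

/-- In a local domain the `v`-ideals have squares similar to themselves (up to `v`-closure)
exactly when the ideals `I = (M : (M : I))` do, with respect to that closure. -/
theorem vSquares_iff_mSquares (hR : ¬ IsField R) :
    (∀ I : FractionalIdeal R⁰ K, I ≠ 0 → vClosure I = I →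
      ∃ c : K, c ≠ 0 ∧ vClosure (I * I) = spanSingleton R⁰ c * I) ↔
    (∀ I : FractionalIdeal R⁰ K, I ≠ 0 → mClosure I = I →
      ∃ c : K, c ≠ 0 ∧ mClosure (I * I) = spanSingleton R⁰ c * I) := by
  have hM : fracMax R K ≠ 0 := fracMax_ne_zero hR
  constructor
  · intro H I hI hIm
    have hII := mul_ne_zero_of_ne_zero hI hI
    by_cases hv : ∃ c, vClosure I = spanSingleton R⁰ c
    · obtain ⟨c, hc⟩ := hv
      have hc0 := ne_zero_of_spanSingleton_eq (vClosure_ne_zero hI) hc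
      by_cases hp : ∃ d, I = spanSingleton R⁰ d
      · obtain ⟨d, hd⟩ := hp
        have hd0 := ne_zero_of_spanSingleton_eq hI hd
        refine ⟨d, hd0, ?_⟩
        calc mClosure (I * I) = mClosure (spanSingleton R⁰ d * I) := by nth_rw 1 [hd]
          _ = _ := by rw [mClosure_spanSingleton_mul hR hI hd0, hIm]
      · push Not at hp
        -- A closed nonprincipal `I` with `I_v` principal is a multiple of `M`, and `M_v = R`.
        have hIM : I = spanSingleton R⁰ c * fracMax R K := by
          rw [← mClosure_eq_of_vClosure_eq hI hp hc, hIm]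
        have hMp : ∀ d, fracMax R K ≠ spanSingleton R⁰ d := fun d hd =>
          hp (c * d) (by rw [hIM, hd, spanSingleton_mul_spanSingleton])
        have hMv : vClosure (fracMax R K) = 1 := by
          rw [hIM, vClosure_spanSingleton_mul hc0] at hc
          rw [← spanSingleton_inv_mul_cancel hc0 (vClosure (fracMax R K)), hc,
            spanSingleton_mul_spanSingleton, inv_mul_cancel₀ hc0, spanSingleton_one]
        refine ⟨c, hc0, ?_⟩
        rw [hIM, mul_mul_mul_comm, spanSingleton_mul_spanSingleton,
          mClosure_spanSingleton_mul hR (mul_ne_zero_of_ne_zero hM hM) (mul_ne_zero hc0 hc0),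
          mClosure_fracMax_mul_fracMax hR hMp hMv, ← mul_assoc, spanSingleton_mul_spanSingleton]
    · push Not at hv
      have hIv : vClosure I = I := by rw [← mClosure_eq_vClosure hI hv, hIm]
      obtain ⟨c, hc, h⟩ := H I hI hIv
      refine ⟨c, hc, ?_⟩
      rw [mClosure_eq_vClosure hII, h]
      intro d hd
      refine hv (c⁻¹ * d) ?_
      rw [hIv, ← spanSingleton_inv_mul_cancel hc I, ← h, hd, spanSingleton_mul_spanSingleton]
  · intro H I hI hIv
    have hII := mul_ne_zero_of_ne_zero hI hI
    by_cases hp : ∃ d, I = spanSingleton R⁰ d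
    · obtain ⟨d, hd⟩ := hp
      have hd0 := ne_zero_of_spanSingleton_eq hI hd
      refine ⟨d, hd0, ?_⟩
      calc vClosure (I * I) = vClosure (spanSingleton R⁰ d * I) := by nth_rw 1 [hd]
        _ = _ := by rw [vClosure_spanSingleton_mul hd0, hIv]
    · push Not at hp
      obtain ⟨c, hc, h⟩ := H I hI (by rw [mClosure_eq_vClosure hI (by rwa [hIv]), hIv])
      refine ⟨c, hc, ?_⟩
      -- A principal `(I²)_v` would make `mClosure (I²)`, hence `I`, a multiple of `M`; then `M` is
      -- divisorial with `(M²)_v` principal, which is impossible.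
      by_cases hv : ∃ d, vClosure (I * I) = spanSingleton R⁰ d
      · exfalso
        obtain ⟨d, hd⟩ := hv
        have hd0 := ne_zero_of_spanSingleton_eq (vClosure_ne_zero hII) hd
        have hIIp : ∀ e, I * I ≠ spanSingleton R⁰ e := by
          intro e he
          have he0 := ne_zero_of_spanSingleton_eq hII he
          refine mul_ne_one_of_ne_spanSingleton hI hp (I * spanSingleton R⁰ e⁻¹) ?_
          rw [← mul_assoc, he, spanSingleton_mul_spanSingleton, mul_inv_cancel₀ he0,
            spanSingleton_one]
        rw [mClosure_eq_of_vClosure_eq hII hIIp hd] at h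
        have hIM : I = spanSingleton R⁰ (c⁻¹ * d) * fracMax R K := by
          rw [← spanSingleton_mul_spanSingleton, mul_assoc, h, spanSingleton_inv_mul_cancel hc]
        have he0 : c⁻¹ * d ≠ 0 := mul_ne_zero (inv_ne_zero hc) hd0
        generalize c⁻¹ * d = e at hIM he0
        have hMp : ∀ a, fracMax R K ≠ spanSingleton R⁰ a := fun a ha =>
          hp (e * a) (by rw [hIM, ha, spanSingleton_mul_spanSingleton])
        have hMv : vClosure (fracMax R K) = fracMax R K := by
          rw [hIM, vClosure_spanSingleton_mul he0] at hIv
          rw [← spanSingleton_inv_mul_cancel he0 (vClosure (fracMax R K)), hIv,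
            spanSingleton_inv_mul_cancel he0]
        refine vClosure_fracMax_mul_fracMax_ne hR hMp hMv ((e * e)⁻¹ * d) ?_
        rw [hIM, mul_mul_mul_comm, spanSingleton_mul_spanSingleton,
          vClosure_spanSingleton_mul (mul_ne_zero he0 he0)] at hd
        rw [← spanSingleton_mul_spanSingleton, ← hd,
          spanSingleton_inv_mul_cancel (mul_ne_zero he0 he0)]
      · push Not at hv
        rw [← mClosure_eq_vClosure hII hv, h]

end LocalSquares

open IsLocalRing

/-! ### Passing between fractional ideals of `R` and of `T`. -/

section Extension

variable {R T K : Type*} [CommRing R] [IsDomain R] [CommRing T] [IsDomain T] [Field K]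
  [Algebra R T] [Algebra R K] [Algebra T K] [IsScalarTower R T K]
  [IsFractionRing R K] [IsFractionRing T K]

theorem algebraMap_ne_zero_of_isFractionRing (R T K : Type*) [CommRing R] [CommRing T]
    [CommRing K] [Algebra R T] [Algebra R K] [Algebra T K] [IsScalarTower R T K]
    [IsFractionRing R K] [Nontrivial R] {r : R} (hr : r ∈ R⁰) : algebraMap R T r ≠ 0 := by
  intro h
  refine nonZeroDivisors.ne_zero hr (IsFractionRing.injective R K ?_)
  rw [IsScalarTower.algebraMap_apply R T K, h, map_zero, map_zero]

variable (T) in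
/-- The fractional ideal of `T` generated by a fractional ideal of a subring `R` with the same
quotient field. -/
def extend (I : FractionalIdeal R⁰ K) : FractionalIdeal T⁰ K :=
  ⟨Submodule.span T (I : Set K), by
    obtain ⟨a, ha, h⟩ := I.isFractional
    refine ⟨algebraMap R T a, mem_nonZeroDivisors_of_ne_zero 
      (algebraMap_ne_zero_of_isFractionRing R T K ha), ?_⟩
    intro x hx
    induction hx using Submodule.span_induction with
    | mem x hx =>
      obtain ⟨r, hr⟩ := h x hx
      exact ⟨algebraMap R T r, by
        rw [← IsScalarTower.algebraMap_apply, hr, algebraMap_smul]⟩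
    | zero => exact ⟨0, by simp⟩
    | add x y _ _ hx hy => rw [smul_add]; exact IsLocalization.isInteger_add hx hy
    | smul t x _ hx => rw [smul_comm]; exact IsLocalization.isInteger_smul hx⟩

theorem mem_extend {I : FractionalIdeal R⁰ K} {x : K} :
    x ∈ extend T I ↔ x ∈ Submodule.span T (I : Set K) := Iff.rfl

theorem mem_extend_of_mem {I : FractionalIdeal R⁰ K} {x : K} (hx : x ∈ I) : x ∈ extend T I :=
  Submodule.subset_span hx

theorem extend_le_iff {I : FractionalIdeal R⁰ K} {Y : FractionalIdeal T⁰ K} :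
    extend T I ≤ Y ↔ ∀ x ∈ I, x ∈ Y := by
  rw [← coe_le_coe]
  exact Submodule.span_le

theorem extend_mono {I J : FractionalIdeal R⁰ K} (h : I ≤ J) : extend T I ≤ extend T J :=
  extend_le_iff.2 fun _ hx => mem_extend_of_mem (h hx)

theorem extend_ne_zero {I : FractionalIdeal R⁰ K} (hI : I ≠ 0) : extend T I ≠ 0 := by
  intro h
  refine hI ((eq_zero_iff).2 fun x hx => ?_)
  exact (eq_zero_iff).1 h x (mem_extend_of_mem hx)

theorem extend_spanSingleton (c : K) :
    extend T (spanSingleton R⁰ c) = spanSingleton T⁰ c := by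
  refine le_antisymm (extend_le_iff.2 fun x hx => ?_) (spanSingleton_le_iff_mem.2
    (mem_extend_of_mem (mem_spanSingleton_self _ c)))
  obtain ⟨r, rfl⟩ := (mem_spanSingleton _).1 hx
  exact (mem_spanSingleton _).2 ⟨algebraMap R T r, by rw [algebraMap_smul]⟩

/-- `IT` is finitely generated over `T`, and its generators can be chosen in `I` itself; their
`R`-span is `J`. -/
theorem exists_fg_le_extend_eq [IsNoetherianRing T] (I : FractionalIdeal R⁰ K) :
    ∃ J : FractionalIdeal R⁰ K, J ≤ I ∧ (J : Submodule R K).FG ∧ extend T J = extend T I := by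
  have hfg : (Submodule.span T (I : Set K)).FG :=
    (isNoetherian_submodule.1 (isNoetherian (extend T I))) _ le_rfl
  obtain ⟨s, hs, hspan⟩ := Submodule.fg_span_iff_fg_span_finset_subset _ |>.1 hfg
  have hsI : Submodule.span R (s : Set K) ≤ (I : Submodule R K) := Submodule.span_le.2 hs
  refine ⟨⟨Submodule.span R (s : Set K), isFractional_of_le hsI⟩, hsI, ⟨s, rfl⟩, ?_⟩
  refine le_antisymm (extend_mono hsI) ?_
  rw [← coe_le_coe]
  change Submodule.span T (I : Set K) ≤ _
  rw [hspan, Submodule.span_le]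
  exact fun x hx => mem_extend_of_mem (Submodule.subset_span hx)

variable [IsLocalRing T]

/-- A local domain `T` over a local subring `R ≠ T` with the same maximal ideal. -/
structure SharesMaximalIdeal (R T : Type*) [CommRing R] [CommRing T] [Algebra R T]
    [IsLocalRing T] : Prop where
  isLocalHom : IsLocalHom (algebraMap R T)
  exists_eq : ∀ m ∈ maximalIdeal T, ∃ r : R, algebraMap R T r = m
  not_surjective : ¬ Function.Surjective (algebraMap R T)
  not_isField : ¬ IsField T

namespace SharesMaximalIdeal

variable (h : SharesMaximalIdeal R T)
include h

theorem isFractional_restrictScalars (Y : FractionalIdeal T⁰ K) :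
    IsFractional R⁰ ((Y : Submodule T K).restrictScalars R) := by
  obtain ⟨a, ha, hY⟩ := Y.isFractional
  have hbot : maximalIdeal T ≠ ⊥ := mt isField_iff_maximalIdeal_eq.2 h.not_isField
  obtain ⟨m, hm, hm0⟩ := Submodule.exists_mem_ne_zero_of_ne_bot hbot
  -- The denominator over `R` is `am`: `a` carries `Y` into `T`, and `m` carries `T` into `M ⊆ R`.
  obtain ⟨r, hr⟩ := h.exists_eq (a * m) (Ideal.mul_mem_left _ _ hm)
  refine ⟨r, mem_nonZeroDivisors_of_ne_zero ?_, fun x hx => ?_⟩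
  · rintro rfl
    rw [map_zero] at hr
    exact mul_ne_zero (nonZeroDivisors.ne_zero ha) hm0 hr.symm
  · obtain ⟨t, ht⟩ := hY x hx
    obtain ⟨s, hs⟩ := h.exists_eq (m * t) (Ideal.mul_mem_right _ _ hm)
    refine ⟨s, ?_⟩
    rw [IsScalarTower.algebraMap_apply R T K, hs, map_mul, ht, Algebra.smul_def, Algebra.smul_def,
      IsScalarTower.algebraMap_apply R T K, hr, map_mul]
    ring

/-- A fractional ideal of `T`, viewed as a fractional ideal of `R`. -/
def restrict (Y : FractionalIdeal T⁰ K) : FractionalIdeal R⁰ K :=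
  ⟨(Y : Submodule T K).restrictScalars R, h.isFractional_restrictScalars Y⟩

theorem mem_restrict {Y : FractionalIdeal T⁰ K} {x : K} : x ∈ h.restrict Y ↔ x ∈ Y := Iff.rfl

theorem restrict_injective {Y Z : FractionalIdeal T⁰ K} (hYZ : h.restrict Y = h.restrict Z) :
    Y = Z := by
  ext x
  rw [← h.mem_restrict, hYZ, h.mem_restrict]

theorem extend_restrict (Y : FractionalIdeal T⁰ K) : extend T (h.restrict Y) = Y :=
  le_antisymm (extend_le_iff.2 fun _ hx => hx) fun _ hx => mem_extend_of_mem hx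

theorem restrict_ne_zero {Y : FractionalIdeal T⁰ K} (hY : Y ≠ 0) : h.restrict Y ≠ 0 := by
  intro h0
  refine hY ((eq_zero_iff).2 fun x hx => ?_)
  exact (eq_zero_iff).1 h0 x hx

theorem restrict_spanSingleton_mul (c : K) (Y : FractionalIdeal T⁰ K) :
    h.restrict (spanSingleton T⁰ c * Y) = spanSingleton R⁰ c * h.restrict Y := by
  ext x
  rw [mem_restrict, mem_singleton_mul, mem_singleton_mul]
  rfl

theorem restrict_mul (Y Z : FractionalIdeal T⁰ K) :
    h.restrict (Y * Z) = h.restrict Y * h.restrict Z := by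
  refine le_antisymm (fun x hx => ?_) (FractionalIdeal.mul_le.2 fun i hi j hj =>
    FractionalIdeal.mul_mem_mul (I := Y) (J := Z) hi hj)
  refine FractionalIdeal.mul_induction_on (I := Y) (J := Z) hx (fun i hi j hj => ?_)
    fun x y hx hy => ?_
  · exact FractionalIdeal.mul_mem_mul (I := h.restrict Y) (J := h.restrict Z) hi hj
  · exact Submodule.add_mem _ hx hy

/-- If `cR` is stable under `T`, then `Tc ⊆ Rc`, so `T = R`. -/
theorem restrict_ne_spanSingleton {Y : FractionalIdeal T⁰ K} (hY : Y ≠ 0) (c : K) :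
    h.restrict Y ≠ spanSingleton R⁰ c := by
  intro hc
  have hc0 := ne_zero_of_spanSingleton_eq (h.restrict_ne_zero hY) hc
  refine h.not_surjective fun t => ?_
  have hcY : c ∈ Y := by
    rw [← h.mem_restrict, hc]
    exact mem_spanSingleton_self _ c
  have htc : t • c ∈ h.restrict Y := Submodule.smul_mem (Y : Submodule T K) t hcY
  rw [hc, mem_spanSingleton] at htc
  obtain ⟨r, hr⟩ := htc
  refine ⟨r, IsFractionRing.injective T K ?_⟩
  rw [Algebra.smul_def, Algebra.smul_def, IsScalarTower.algebraMap_apply R T K] at hr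
  exact mul_right_cancel₀ hc0 hr

/-- Enlarging a principal ideal inside its extension to `T` destroys principality. -/
theorem spanSingleton_sup_ne {a b : K} (ha : a ≠ 0) (hb : b ∉ spanSingleton R⁰ a)
    (hbT : b ∈ spanSingleton T⁰ a) (c : K) :
    spanSingleton R⁰ a ⊔ spanSingleton R⁰ b ≠ spanSingleton R⁰ c := by
  have := h.isLocalHom
  intro hc
  have hac : a ∈ spanSingleton R⁰ c := by
    rw [← hc]; exact (le_sup_left : spanSingleton R⁰ a ≤ _) (mem_spanSingleton_self _ a)
  have hbc : b ∈ spanSingleton R⁰ c := by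
    rw [← hc]; exact (le_sup_right : spanSingleton R⁰ b ≤ _) (mem_spanSingleton_self _ b)
  have hca : c ∈ spanSingleton T⁰ a := by
    have hle : spanSingleton R⁰ a ⊔ spanSingleton R⁰ b ≤ h.restrict (spanSingleton T⁰ a) :=
      sup_le (spanSingleton_le_iff_mem.2 (mem_spanSingleton_self _ a))
        (spanSingleton_le_iff_mem.2 hbT)
    exact hle (hc ▸ mem_spanSingleton_self _ c)
  obtain ⟨r, hr⟩ := (mem_spanSingleton _).1 hac
  obtain ⟨t, ht⟩ := (mem_spanSingleton _).1 hca
  -- From `a = rc` and `c = ta`, `r` is a unit of `T`, hence of `R`; so `cR = aR` already contains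
  -- `b`.
  have hrt : algebraMap R T r * t = 1 := by
    apply IsFractionRing.injective T K
    apply mul_right_cancel₀ ha
    rw [map_one, one_mul, map_mul, ← IsScalarTower.algebraMap_apply, mul_assoc,
      ← Algebra.smul_def t, ht, ← Algebra.smul_def, hr]
  obtain ⟨u, rfl⟩ := isUnit_of_map_unit (algebraMap R T) r (IsUnit.of_mul_eq_one _ hrt)
  obtain ⟨s, hs⟩ := (mem_spanSingleton _).1 hbc
  refine hb ((mem_spanSingleton _).2 ⟨s * ((u⁻¹ : Rˣ) : R), ?_⟩)
  rw [← hr, smul_smul, mul_assoc, Units.inv_mul, mul_one, hs]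

variable [IsLocalRing R]

theorem fracMax_eq_restrict : fracMax R K = h.restrict (fracMax T K) := by
  have := h.isLocalHom
  ext x
  rw [mem_restrict, mem_fracMax, mem_fracMax]
  constructor
  · rintro ⟨r, hr, rfl⟩
    refine ⟨algebraMap R T r, ?_, (IsScalarTower.algebraMap_apply R T K r).symm⟩
    rw [mem_maximalIdeal, mem_nonunits_iff] at hr ⊢
    exact fun hu => hr (isUnit_of_map_unit (algebraMap R T) r hu)
  · rintro ⟨m, hm, rfl⟩
    obtain ⟨r, rfl⟩ := h.exists_eq m hm
    refine ⟨r, ?_, IsScalarTower.algebraMap_apply R T K r⟩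
    rw [mem_maximalIdeal, mem_nonunits_iff] at hm ⊢
    exact fun hr => hm (hr.map _)

/-- `M` is a `T`-module, so `xI ⊆ M` forces `x(IT) ⊆ M`. -/
theorem fracMax_div_eq {I : FractionalIdeal R⁰ K} (hI : I ≠ 0) :
    fracMax R K / I = h.restrict (fracMax T K / extend T I) := by
  ext x
  rw [mem_restrict, mem_div_iff_of_ne_zero hI, mem_div_iff_of_ne_zero (extend_ne_zero hI),
    h.fracMax_eq_restrict]
  refine ⟨fun hx y hy => ?_, fun hx y hy => hx y (mem_extend_of_mem hy)⟩
  rw [mem_extend] at hy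
  induction hy using Submodule.span_induction with
  | mem y hy => exact hx y hy
  | zero => rw [mul_zero]; exact Submodule.zero_mem (fracMax T K : Submodule T K)
  | add y z _ _ hy hz =>
    rw [mul_add]; exact Submodule.add_mem (fracMax T K : Submodule T K) hy hz
  | smul t y _ hy =>
    rw [mul_smul_comm]; exact Submodule.smul_mem (fracMax T K : Submodule T K) t hy

theorem inv_eq_restrict {I : FractionalIdeal R⁰ K} (hI : I ≠ 0)
    (hp : ∀ c, I ≠ spanSingleton R⁰ c) :
    I⁻¹ = h.restrict (fracMax T K / extend T I) := by
  rw [inv_eq_fracMax_div hI hp, h.fracMax_div_eq hI]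

/-- The formula for the inverse applies twice, since `(M : IT)` is a `T`-module and so not principal
over `R`. -/
theorem vClosure_eq_restrict {I : FractionalIdeal R⁰ K} (hI : I ≠ 0)
    (hp : ∀ c, I ≠ spanSingleton R⁰ c) :
    vClosure I = h.restrict (mClosure (extend T I)) := by
  have hne : fracMax T K / extend T I ≠ 0 :=
    div_ne_zero_of_ne_zero (fracMax_ne_zero h.not_isField) (extend_ne_zero hI)
  rw [vClosure, h.inv_eq_restrict hI hp, h.inv_eq_restrict (h.restrict_ne_zero hne)
    (h.restrict_ne_spanSingleton hne), h.extend_restrict, mClosure]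

/-- For nonprincipal `I`, `I_v` depends only on `IT`; it is therefore `J_v` for any finitely
generated nonprincipal `J ⊆ I` with `JT = IT`. -/
theorem tClosure_eq_vClosure [IsNoetherianRing T] (I : FractionalIdeal R⁰ K) :
    tClosure I = vClosure I := by
  by_cases hI : I = 0
  · rw [hI, vClosure_zero]
    exact le_antisymm ((tClosure_le_vClosure _).trans vClosure_zero.le) (zero_le _)
  by_cases hp : ∃ c, I = spanSingleton R⁰ c
  · obtain ⟨c, rfl⟩ := hp
    refine tClosure_eq_vClosure_of_fg_le ?_ le_rfl le_rfl
    rw [coe_spanSingleton]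
    exact Submodule.fg_span_singleton c
  push Not at hp
  suffices ∃ J : FractionalIdeal R⁰ K, J ≤ I ∧ (J : Submodule R K).FG ∧
      extend T J = extend T I ∧ ∀ c, J ≠ spanSingleton R⁰ c by
    obtain ⟨J, hJI, hJf, hJ, hJp⟩ := this
    have hJ0 : J ≠ 0 := fun h0 => hJp 0 (by rw [h0, spanSingleton_zero])
    refine tClosure_eq_vClosure_of_fg_le hJf hJI ?_
    rw [h.vClosure_eq_restrict hI hp, h.vClosure_eq_restrict hJ0 hJp, hJ]
  obtain ⟨J, hJI, hJf, hJ⟩ := exists_fg_le_extend_eq (T := T) I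
  -- If the chosen `J` is `aR`, adjoining some `b ∈ I` outside it keeps the extension to `T` and
  -- destroys principality.
  by_cases hJp : ∃ a, J = spanSingleton R⁰ a
  · obtain ⟨a, rfl⟩ := hJp
    have ha : a ≠ 0 := by
      rintro rfl
      rw [extend_spanSingleton, spanSingleton_zero] at hJ
      exact extend_ne_zero hI hJ.symm
    obtain ⟨b, hbI, hb⟩ : ∃ b ∈ I, b ∉ spanSingleton R⁰ a := by
      by_contra! hall
      exact hp a (le_antisymm hall hJI)
    have hbI' := spanSingleton_le_iff_mem.2 hbI
    refine ⟨spanSingleton R⁰ a ⊔ spanSingleton R⁰ b, sup_le hJI hbI', ?_, ?_, ?_⟩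
    · rw [coe_sup]
      refine hJf.sup ?_
      rw [coe_spanSingleton]
      exact Submodule.fg_span_singleton b
    · exact le_antisymm (extend_mono (sup_le hJI hbI')) (hJ.ge.trans (extend_mono le_sup_left))
    · refine h.spanSingleton_sup_ne ha hb ?_
      rw [← extend_spanSingleton (R := R), hJ]
      exact mem_extend_of_mem hbI
  · push Not at hJp
    exact ⟨J, hJI, hJf, hJ, hJp⟩

theorem tClosure_restrict [IsNoetherianRing T] {Y : FractionalIdeal T⁰ K} (hY : Y ≠ 0) :
    tClosure (h.restrict Y) = h.restrict (mClosure Y) := by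
  rw [h.tClosure_eq_vClosure, h.vClosure_eq_restrict (h.restrict_ne_zero hY)
    (h.restrict_ne_spanSingleton hY), h.extend_restrict]

/-- Principal ideals satisfy the condition trivially; the other `t`-ideals of `R` are the closed
ideals of `T`, with products and multiples computed alike over both rings. -/
theorem tSquaresSimilar_iff_mSquares [IsNoetherianRing T] :
    TSquaresSimilar R K ↔ ∀ Y : FractionalIdeal T⁰ K, Y ≠ 0 → mClosure Y = Y →
      ∃ c : K, c ≠ 0 ∧ mClosure (Y * Y) = spanSingleton T⁰ c * Y := by
  constructor
  · intro H Y hY hYm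
    obtain ⟨c, hc, hcY⟩ := H (h.restrict Y) (h.restrict_ne_zero hY)
      (by rw [h.tClosure_restrict hY, hYm])
    refine ⟨c, hc, h.restrict_injective ?_⟩
    rw [h.restrict_spanSingleton_mul, ← hcY, ← h.restrict_mul,
      h.tClosure_restrict (mul_ne_zero_of_ne_zero hY hY)]
  · intro H I hI hIt
    by_cases hp : ∃ c, I = spanSingleton R⁰ c
    · obtain ⟨c, hcI⟩ := hp
      have hc := ne_zero_of_spanSingleton_eq hI hcI
      refine ⟨c, hc, ?_⟩
      calc tClosure (I * I) = tClosure (spanSingleton R⁰ c * I) := by nth_rw 1 [hcI]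
        _ = _ := by rw [tClosure_spanSingleton_mul hc, hIt]
    · push Not at hp
      have hIY : I = h.restrict (mClosure (extend T I)) := by
        rw [← h.vClosure_eq_restrict hI hp, ← h.tClosure_eq_vClosure, hIt]
      have hY : mClosure (extend T I) ≠ 0 := mClosure_ne_zero h.not_isField (extend_ne_zero hI)
      generalize mClosure (extend T I) = Y at hIY hY
      subst hIY
      obtain ⟨c, hc, hcY⟩ := H Y hY (h.restrict_injective (by rw [← h.tClosure_restrict hY, hIt]))
      refine ⟨c, hc, ?_⟩
      rw [← h.restrict_mul, h.tClosure_restrict (mul_ne_zero_of_ne_zero hY hY), hcY,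
        h.restrict_spanSingleton_mul]

end SharesMaximalIdeal

end Extension

/-! ### The pullback of a proper subfield of the residue field. -/

section Pullback

variable {T : Type*} [CommRing T] [IsDomain T] [IsLocalRing T] (k : Subfield (ResidueField T))

theorem exists_mul_eq_one_of_mem_comap {t : T} (ht : t ∈ k.toSubring.comap (residue T))
    {s : T} (hs : t * s = 1) : s ∈ k.toSubring.comap (residue T) := by
  have hst : residue T s = (residue T t)⁻¹ := by
    refine eq_inv_of_mul_eq_one_right ?_
    rw [← map_mul, hs, map_one]
  change residue T s ∈ k
  rw [hst]
  exact k.inv_mem ht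

theorem isLocalHom_comap_residue :
    IsLocalHom (algebraMap (k.toSubring.comap (residue T)) T) := by
  refine ⟨fun r hr => ?_⟩
  obtain ⟨s, hs⟩ := hr.exists_right_inv
  exact IsUnit.of_mul_eq_one ⟨s, exists_mul_eq_one_of_mem_comap k r.2 hs⟩ (Subtype.ext hs)

theorem isLocalRing_comap_residue : IsLocalRing (k.toSubring.comap (residue T)) := by
  have := isLocalHom_comap_residue k
  exact RingHom.domain_isLocalRing (algebraMap (k.toSubring.comap (residue T)) T)

theorem mem_comap_residue_of_mem_maximalIdeal {m : T} (hm : m ∈ maximalIdeal T) :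
    m ∈ k.toSubring.comap (residue T) := by
  change residue T m ∈ k
  rw [(residue_eq_zero_iff m).2 hm]
  exact k.zero_mem

theorem sharesMaximalIdeal_comap_residue (hk : k ≠ ⊤) (hT : ¬ IsField T) :
    SharesMaximalIdeal (k.toSubring.comap (residue T)) T where
  isLocalHom := isLocalHom_comap_residue k
  exists_eq m hm := ⟨⟨m, mem_comap_residue_of_mem_maximalIdeal k hm⟩, rfl⟩
  not_surjective hsurj := by
    refine hk (eq_top_iff.2 fun x _ => ?_)
    obtain ⟨t, rfl⟩ := residue_surjective x
    obtain ⟨r, rfl⟩ := hsurj t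
    exact r.2
  not_isField := hT

theorem isFractionRing_comap_residue (hT : ¬ IsField T) (K : Type*) [Field K] [Algebra T K]
    [IsFractionRing T K] : IsFractionRing (k.toSubring.comap (residue T)) K := by
  have : FaithfulSMul (k.toSubring.comap (residue T)) K := by
    rw [faithfulSMul_iff_algebraMap_injective]
    exact (IsFractionRing.injective T K).comp Subtype.val_injective
  refine IsFractionRing.of_field _ _ fun z => ?_
  have hbot : maximalIdeal T ≠ ⊥ := mt isField_iff_maximalIdeal_eq.2 hT
  obtain ⟨m, hm, hm0⟩ := Submodule.exists_mem_ne_zero_of_ne_bot hbot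
  obtain ⟨a, b, -, rfl⟩ := IsFractionRing.div_surjective (A := T) z
  -- `a/b = (ma)/(mb)` with `0 ≠ m ∈ M` puts numerator and denominator in `M`, hence in the
  -- pullback.
  refine ⟨⟨m * a, mem_comap_residue_of_mem_maximalIdeal k (Ideal.mul_mem_right _ _ hm)⟩,
    ⟨m * b, mem_comap_residue_of_mem_maximalIdeal k (Ideal.mul_mem_right _ _ hm)⟩, ?_⟩
  change _ = algebraMap T K (m * a) / algebraMap T K (m * b)
  have hm' : algebraMap T K m ≠ 0 := by
    rwa [Ne, map_eq_zero_iff _ (IsFractionRing.injective T K)]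
  rw [map_mul, map_mul, mul_div_mul_left _ _ hm']

theorem isField_comap_residue (hT : IsField T) : IsField (k.toSubring.comap (residue T)) where
  exists_pair_ne := exists_pair_ne _
  mul_comm := mul_comm
  mul_inv_cancel {a} ha := by
    obtain ⟨s, hs⟩ := hT.mul_inv_cancel (fun h => ha (Subtype.ext h) : (a : T) ≠ 0)
    exact ⟨⟨s, exists_mul_eq_one_of_mem_comap k a.2 hs⟩, Subtype.ext hs⟩

theorem isBooleTRegular_comap_residue_iff [IsNoetherianRing T] (hk : k ≠ ⊤) (hT : ¬ IsField T)
    (K : Type*) [Field K] [Algebra T K] [IsFractionRing T K] :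
    IsBooleTRegular (k.toSubring.comap (residue T)) ↔ IsBooleTRegular T := by
  have := isFractionRing_comap_residue k hT K
  have := isLocalRing_comap_residue k
  rw [isBooleTRegular_iff _ K, isBooleTRegular_iff T K,
    (sharesMaximalIdeal_comap_residue k hk hT).tSquaresSimilar_iff_mSquares,
    ← vSquares_iff_mSquares hT]
  -- On the Noetherian ring `T`, the `t`-condition is the `v`-condition.
  simp only [TSquaresSimilar, tClosure_eq_vClosure]

end Pullback

end TClass

end

theorem proposition2p3 {T : Type*} [CommRing T] [IsDomain T] [IsLocalRing T] [IsNoetherianRing T]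
    (k : Subfield (IsLocalRing.ResidueField T)) (hk : k ≠ ⊤) :
    TClass.IsBooleTRegular (k.toSubring.comap (IsLocalRing.residue T)) ↔
      TClass.IsBooleTRegular T := by
  -- For a field `M = 0`: the closure by `M` degenerates and the quotient fields of `R` and `T` need
  -- not agree.
  by_cases hT : IsField T
  · exact iff_of_true (TClass.isBooleTRegular_of_isField (TClass.isField_comap_residue k hT))
      (TClass.isBooleTRegular_of_isField hT)
  exact TClass.isBooleTRegular_comap_residue_iff k hk hT (FractionRing T)
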